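/- Let $q\ge 2$. Let $C\subset\mathbb R^q$ be a solid, pointed, nontrivial polyhedral cone with dual cone $C^+$, let $X\subset\mathbb R^n$ be compact and convex with nonempty interior, and let $\Gamma:X\to\mathbb R^q$ be continuous and $C$-convex. Put $P:=\Gamma(X)+C$, fix $\bar w\in\operatorname{int}C^+$ and $\gamma\in\mathbb R$ with $\Gamma(X)\subset\operatorname{int}S(\gamma)$, where $S(\gamma):=\{y:\bar w^\top y\le\gamma\}$, and let $A:=P\cap S(\gamma)$. For a symmetric positive definite matrix $M$ write $\|y\|_M:=\sqrt{y^\top My}$ and $\kappa(M):=\lambda_{\max}(M)/\lambda_{\min}(M)$. For $v\in\mathbb R^q$ let $(\mathrm P_M(v))$ be the problem of minimizing $\|z\|_M$ over $x\in X$, $z\in\mathbb R^q$ with $v+z-\Gamma(x)\in C$ and $\bar w^\top(v+z)\le\gamma$, and let $(\mathrm D_M(v))$ be its Lagrange dual: maximize, over $w\in C^+$ and $\lambda\ge0$, $$\inf_{x\in X,\,z\in\mathbb R^q}\bigl(\|z\|_M+w^\top(\Gamma(x)-z-v)+\lambda(\bar w^\top(v+z)-\gamma)\bigr).$$ Let $\varepsilon_0>0$.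 Consider an infinite run of the adaptive-metric algorithm: $A_0\supseteq A$ is a polytope and, for every $k\ge0$, (1) $M_k=\varepsilon_0I+\frac1k\sum_{i=1}^k u_iu_i^\top$ (with $M_0=\varepsilon_0I$), where $u_1,\dots,u_k$ are the unit cut-normals of the first $k$ iterations; (2) for every vertex $v$ of $A_k$ an optimal solution $(x^v,z^v)$ of $(\mathrm P_{M_k}(v))$ is computed, and $v^k$ is a vertex of $A_k$ that maximizes $\|z^v\|_{M_k}$; put $z^k:=z^{v^k}$ and $y^k:=v^k+z^k$; (3) $(w^k,\lambda^k)$ is an optimal solution of $(\mathrm D_{M_k}(v^k))$, $g^k:=w^k-\lambda^k\bar w$, and $A_{k+1}=A_k\cap H_k$ with $H_k:=\{y:(g^k)^\top y\ge(g^k)^\top y^k\}$; (4) $u_{k+1}=g^k/\|g^k\|_2$ (any unit vector if $g^k=0$). Let $\delta_H$ be the Euclidean Hausdorff distance, $E_k:=\delta_H(A_k,A)$, $\bar\theta:=\sup_k\sqrt{\kappa(M_k)}$ and $r:=1/\bar\theta^3$. Then $\bar\theta<\infty$ and $\delta_H(A_k,A_{k+1})\ge r\,E_k$ for all $k\ge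 0$. If moreover $A_0$ is a sliced initial approximation $A_0=\bigcap_{j=1}^J\mathcal H(\omega_j,A)\cap S(\gamma)$ with $\omega_j\ne0$, where $\mathcal H(\omega,A):=\{y:\omega^\top y\ge\inf_{a\in A}\omega^\top a\}$, then $(A_k)_{k\ge0}$ is an $H(r,A)$-sequence of cutting; that is, $A$ is nonempty, convex and compact, $r>0$, the $A_k$ are polytopes that contain $A$, $A_0$ is a finite intersection of halfspaces $\mathcal H(\omega,A)$ with $\omega\neq0$, for each $k$ there is $w\ne0$ with $A_{k+1}=A_k\cap\mathcal H(w,A)$, and $\delta_H(A_k,A_{k+1})\ge r\,\delta_H(A_k,A)$. Furthermore, there is a constant $\lambda(r,A)$, depending only on $A$ and $r$, such that for every such run and every $\varepsilon\in(0,1)$ there is $K\in\mathbb N$ with $$E_k\le(1+\varepsilon)\,\lambda\!\left(\frac1{\bar\theta^3},A\right)k^{\frac1{1-q}}\qquad\text{for all }k\ge K.$$ -/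

import Mathlib

open scoped Matrix

noncomputable section

namespace AdaptiveCVOP

/-- The space `ℝ^d` with its Euclidean norm. -/
abbrev E (d : ℕ) : Type := EuclideanSpace ℝ (Fin d)

/-- The halfspace `S(γ) = {y | w̄ᵀ y ≤ γ}`. -/
def capHalfspace {q : ℕ} (wbar : E q) (γ : ℝ) : Set (E q) :=
  {y | inner ℝ wbar y ≤ γ}

/-- The support function `h_A(w) = inf_{y ∈ A} wᵀ y`. -/
def supportFn {q : ℕ} (A : Set (E q)) (w : E q) : ℝ :=
  sInf ((fun y => inner ℝ w y) '' A)

/-- The supporting halfspace `{y | wᵀ y ≥ h_A(w)}` of `A`. -/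
def suppHalfspace {q : ℕ} (w : E q) (A : Set (E q)) : Set (E q) :=
  {y | supportFn A w ≤ inner ℝ w y}

/-- A polytope: a bounded intersection of finitely many closed halfspaces. -/
def IsPolytope {q : ℕ} (S : Set (E q)) : Prop :=
  (∃ (N : ℕ) (a : Fin N → E q) (b : Fin N → ℝ), S = {y | ∀ i, b i ≤ inner ℝ (a i) y}) ∧
    Bornology.IsBounded S

/-- A polyhedral (closed convex) cone: a finite intersection of homogeneous halfspaces. -/
def IsPolyhedralCone {q : ℕ} (C : Set (E q)) : Prop :=
  ∃ (N : ℕ) (a : Fin N → E q), C = {y | ∀ i, 0 ≤ inner ℝ (a i) y}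

/-- The norm `‖y‖_M = √(yᵀ M y)`. -/
def mnorm {q : ℕ} (M : Matrix (Fin q) (Fin q) ℝ) (y : E q) : ℝ :=
  Real.sqrt (y.ofLp ⬝ᵥ (M *ᵥ y.ofLp))

/-- The spectral condition number: largest eigenvalue over smallest eigenvalue
(used for symmetric positive definite matrices). -/
def condNumber {q : ℕ} (M : Matrix (Fin q) (Fin q) ℝ) : ℝ :=
  sSup (spectrum ℝ M) / sInf (spectrum ℝ M)

/-- The adaptive metric `M_k = ε₀ I + (1/k) ∑_{i<k} u_i u_iᵀ`, the sum running over the `k`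
normals generated before iteration `k`; the average is empty for `k = 0`, so `M_0 = ε₀ I`. -/
def adaptiveMetric {q : ℕ} (ε₀ : ℝ) (u : ℕ → E q) (k : ℕ) : Matrix (Fin q) (Fin q) ℝ :=
  ε₀ • (1 : Matrix (Fin q) (Fin q) ℝ) +
    (1 / (k : ℝ)) • ∑ i ∈ Finset.range k, Matrix.vecMulVec (u i).ofLp (u i).ofLp

/-- A convex vector optimization problem `min Γ(x)` with respect to the order of the cone `C`,
subject to `x ∈ X`, together with the data `w̄`, `γ` of the slice. -/
structure Problem (n q : ℕ) where
  /-- the feasible set -/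
  X : Set (E n)
  /-- the objective map; only its values on `X` matter -/
  Γ : E n → E q
  /-- the ordering cone -/
  C : Set (E q)
  /-- the normal of the slicing halfspace -/
  wbar : E q
  /-- the level of the slicing halfspace -/
  γ : ℝ
  cone_polyhedral : IsPolyhedralCone C
  cone_solid : (interior C).Nonempty
  cone_pointed : ∀ y, y ∈ C → -y ∈ C → y = 0
  cone_ne_zero : C ≠ {0}
  cone_ne_univ : C ≠ Set.univ
  X_nonempty : X.Nonempty
  X_compact : IsCompact X
  X_convex : Convex ℝ X
  X_interior : (interior X).Nonempty
  Γ_continuous : ContinuousOn Γ X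
  Γ_convex : ∀ x₁ ∈ X, ∀ x₂ ∈ X, ∀ t : ℝ, 0 ≤ t → t ≤ 1 →
    (t • Γ x₁ + (1 - t) • Γ x₂) - Γ (t • x₁ + (1 - t) • x₂) ∈ C
  wbar_mem : wbar ∈ interior (ProperCone.innerDual C : Set (E q))
  image_subset : Γ '' X ⊆ interior (capHalfspace wbar γ)

namespace Problem

variable {n q : ℕ} (p : Problem n q)

/-- The dual cone `C⁺`. -/
def dualCone : Set (E q) := (ProperCone.innerDual p.C : Set (E q))

/-- The upper image `P = Γ(X) + C`. -/
def upperImage : Set (E q) := {y | ∃ x ∈ p.X, ∃ c ∈ p.C, y = p.Γ x + c}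

/-- The slice `A = P ∩ S(γ)`. -/
def slice : Set (E q) := p.upperImage ∩ capHalfspace p.wbar p.γ

/-- Feasibility for the scalarization at `v`: `x ∈ X`, `Γ(x) - z - v ≤_C 0`, `w̄ᵀ(v+z) ≤ γ`. -/
def PrimalFeasible (v : E q) (x : E n) (z : E q) : Prop :=
  x ∈ p.X ∧ v + z - p.Γ x ∈ p.C ∧ inner ℝ p.wbar (v + z) ≤ p.γ

/-- `(x, z)` is an optimal solution of: minimize `‖z‖_M` over the feasible pairs. -/
def IsPrimalOptimal (M : Matrix (Fin q) (Fin q) ℝ) (v : E q) (x : E n) (z : E q) : Prop :=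
  p.PrimalFeasible v x z ∧ ∀ x' z', p.PrimalFeasible v x' z' → mnorm M z ≤ mnorm M z'

/-- The Lagrangian
`‖z‖_M + wᵀ(Γ(x) - z - v) + l (w̄ᵀ(v+z) - γ)`. -/
def lagrangian (M : Matrix (Fin q) (Fin q) ℝ) (v : E q) (x : E n) (z w : E q) (l : ℝ) : ℝ :=
  mnorm M z + inner ℝ w (p.Γ x - z - v) + l * (inner ℝ p.wbar (v + z) - p.γ)

/-- The dual objective `inf_{x ∈ X, z} L(x, z; w, l)`, possibly `-∞`. -/
def dualObjective (M : Matrix (Fin q) (Fin q) ℝ) (v w : E q) (l : ℝ) : EReal :=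
  ⨅ x ∈ p.X, ⨅ z : E q, ((p.lagrangian M v x z w l : ℝ) : EReal)

/-- `(w, l)` is an optimal solution of: maximize the dual objective over `w ∈ C⁺`, `l ≥ 0`. -/
def IsDualOptimal (M : Matrix (Fin q) (Fin q) ℝ) (v w : E q) (l : ℝ) : Prop :=
  w ∈ p.dualCone ∧ 0 ≤ l ∧
    ∀ w' ∈ p.dualCone, ∀ l' : ℝ, 0 ≤ l' → p.dualObjective M v w' l' ≤ p.dualObjective M v w l

end Problem

/-- An infinite run of the adaptive-metric outer approximation algorithm, with regularization
parameter `ε₀`. -/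
structure Run {n q : ℕ} (p : Problem n q) (ε₀ : ℝ) where
  /-- the outer approximations `A_k` of the slice -/
  approx : ℕ → Set (E q)
  /-- the `x`-part of the solution of the scalarization at iteration `k` and vertex `v` -/
  xsol : ℕ → E q → E n
  /-- the `z`-part `z^v` of the solution of the scalarization at iteration `k` and vertex `v` -/
  zsol : ℕ → E q → E q
  /-- the selected vertex `v^k` -/
  vertex : ℕ → E q
  /-- the `w`-part of the dual solution at `v^k` -/
  dualVec : ℕ → E q
  /-- the `λ`-part of the dual solution at `v^k` -/
  dualMul : ℕ → ℝ
  /-- the normalized cut-normal of the cut made at iteration `k` -/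
  u : ℕ → E q
  init_polytope : IsPolytope (approx 0)
  init_outer : p.slice ⊆ approx 0
  primal_optimal : ∀ k, ∀ v ∈ Set.extremePoints ℝ (approx k),
    p.IsPrimalOptimal (adaptiveMetric ε₀ u k) v (xsol k v) (zsol k v)
  vertex_mem : ∀ k, vertex k ∈ Set.extremePoints ℝ (approx k)
  vertex_max : ∀ k, ∀ v ∈ Set.extremePoints ℝ (approx k),
    mnorm (adaptiveMetric ε₀ u k) (zsol k v) ≤ mnorm (adaptiveMetric ε₀ u k) (zsol k (vertex k))
  dual_optimal : ∀ k,
    p.IsDualOptimal (adaptiveMetric ε₀ u k) (vertex k) (dualVec k) (dualMul k)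
  /-- the cut `A_{k+1} = A_k ∩ {y | (g^k)ᵀ y ≥ (g^k)ᵀ y^k}` with cut-normal
  `g^k = w^k - λ^k w̄` and `y^k = v^k + z^k` -/
  update : ∀ k, approx (k + 1) = approx k ∩
    {y | inner ℝ (dualVec k - dualMul k • p.wbar) (vertex k + zsol k (vertex k)) ≤
      inner ℝ (dualVec k - dualMul k • p.wbar) y}
  u_unit : ∀ k, ‖u k‖ = 1
  /-- `u_k = g^k / ‖g^k‖` if `g^k ≠ 0`; if `g^k = 0` (which can only happen once the selected
  vertex lies in the slice), `u_k` is an arbitrary unit vector -/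
  u_normal : ∀ k, dualVec k - dualMul k • p.wbar =
    ‖dualVec k - dualMul k • p.wbar‖ • u k

namespace Run

variable {n q : ℕ} {p : Problem n q} {ε₀ : ℝ} (R : Run p ε₀)

/-- The metric `M_k` used at iteration `k` of the run. -/
def metric (k : ℕ) : Matrix (Fin q) (Fin q) ℝ := adaptiveMetric ε₀ R.u k

/-- `θ̄ = sup_k √κ(M_k)`. -/
def thetaBar : ℝ := ⨆ k : ℕ, Real.sqrt (condNumber (R.metric k))

/-- The Euclidean Hausdorff error `E_k = δ_H(A_k, A)`. -/
def error (k : ℕ) : ℝ := Metric.hausdorffDist (R.approx k) p.slice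

end Run

/-- `(S_k)` is an `H(r, A)`-sequence of cutting. -/
structure IsHSequence {q : ℕ} (r : ℝ) (A : Set (E q)) (S : ℕ → Set (E q)) : Prop where
  body_nonempty : A.Nonempty
  body_convex : Convex ℝ A
  body_compact : IsCompact A
  ratio_pos : 0 < r
  polytope : ∀ k, IsPolytope (S k)
  init : ∃ (I : ℕ) (ω : Fin I → E q), (∀ i, ω i ≠ 0) ∧ S 0 = ⋂ i, suppHalfspace (ω i) A
  outer : ∀ k, A ⊆ S k
  cut : ∀ k, ∃ w : E q, w ≠ 0 ∧ S (k + 1) = S k ∩ suppHalfspace w A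
  ratio : ∀ k, r * Metric.hausdorffDist (S k) A ≤ Metric.hausdorffDist (S k) (S (k + 1))

end AdaptiveCVOP

end

noncomputable section

namespace AdaptiveCVOP

/-! ### Quadratic norms and their spectral bounds -/

section Metric

variable {q : ℕ} {M : Matrix (Fin q) (Fin q) ℝ}

/-! Eliminating `x`, the scalarization at `v` is the projection of `v` onto the slice `A` in the
norm of `M` (`exists_primalFeasible_iff`). Let `m` be its value at the selected vertex. Every vertex
of `A_k` lies in the convex closed set `A + {‖z‖_M ≤ m}`, hence so does `A_k`, and `√λ_min · E_k ≤
m`. By strong duality (`mnorm_le_dualObjective`) the cut-normal `g` lies in the dual unit ball of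
`‖·‖_M` and satisfies `g · z = m` at the optimal `z`. So the cut supports `A`, and `‖g‖ ≤ √λ_max`
puts `v^k` at distance at least `m / √λ_max` from `A_{k+1}`. Together these give `dist(v^k, A_{k+1})
≥ E_k / √κ(M_k)`, while `ε₀ I ≤ M_k ≤ (ε₀ + 1) I` keeps `κ` bounded.

The rate is a packing argument (`exists_isRateConstant`). Later vertices lie in `A_{k+1}`, so `v^k`
is at distance at least `r E_k` from all of them and from `A`. The vertices with `ε ≤ E_k ≤ 2ε`
carry disjoint balls of radius `rε/2` inside a shell around `A` of volume `O(ε)`, so there are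
`O(ε^(1-q))` of them. Summing over dyadic scales bounds the number of `k` with `E_k ≥ ε`, and `ε =
E_k` gives the decay. -/

lemma norm_sq_eq_dotProduct (y : E q) : ‖y‖ ^ 2 = y.ofLp ⬝ᵥ y.ofLp := by
  rw [EuclideanSpace.real_norm_sq_eq]
  simp [dotProduct, sq]

lemma inner_eq_dotProduct (x y : E q) : inner ℝ x y = x.ofLp ⬝ᵥ y.ofLp := by
  simp [PiLp.inner_apply, dotProduct, mul_comm]

/-- Factor `M = Bᵀ B`. This makes the triangle inequality, homogeneity and Hilbert-space projection
available for `mnorm`. -/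
lemma exists_clm_norm_eq_mnorm (hM : M.PosSemidef) :
    ∃ L : E q →L[ℝ] E q, ∀ y, mnorm M y = ‖L y‖ := by
  open scoped MatrixOrder in
  obtain ⟨B, hB⟩ := CStarAlgebra.nonneg_iff_eq_star_mul_self.mp hM.nonneg
  refine ⟨LinearMap.toContinuousLinearMap (Matrix.toEuclideanLin B), fun y => ?_⟩
  rw [mnorm, ← Real.sqrt_sq (norm_nonneg _), norm_sq_eq_dotProduct, hB]
  simp [Matrix.star_eq_conjTranspose, ← Matrix.mulVec_mulVec, Matrix.dotProduct_mulVec,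
    Matrix.vecMul_transpose]

lemma mnorm_sq (hM : M.PosSemidef) (y : E q) : mnorm M y ^ 2 = y.ofLp ⬝ᵥ (M *ᵥ y.ofLp) :=
  Real.sq_sqrt (by simpa using hM.dotProduct_mulVec_nonneg y.ofLp)

lemma finite_spectrum (hM : M.IsHermitian) : (spectrum ℝ M).Finite := by
  rw [hM.spectrum_real_eq_range_eigenvalues]
  exact Set.finite_range _

lemma mul_dotProduct_le_of_forall_spectrum (hM : M.IsHermitian) {a : ℝ}
    (ha : ∀ μ ∈ spectrum ℝ M, a ≤ μ) (y : Fin q → ℝ) : a * (y ⬝ᵥ y) ≤ y ⬝ᵥ (M *ᵥ y) := by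
  -- Subtracting `a I` shifts the spectrum by `a`, so it becomes nonnegative.
  have h : (M - algebraMap ℝ _ a).PosSemidef := by
    rw [Matrix.posSemidef_iff_isHermitian_and_spectrum_nonneg]
    refine ⟨hM.sub ?_, ?_⟩
    · rw [Algebra.algebraMap_eq_smul_one]
      simp [Matrix.IsHermitian]
    · rw [← spectrum.sub_singleton_eq]
      rintro _ ⟨μ, hμ, _, rfl, rfl⟩
      simpa using ha μ hμ
  have := h.dotProduct_mulVec_nonneg y
  simp only [Algebra.algebraMap_eq_smul_one, Matrix.sub_mulVec, Matrix.smul_mulVec,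
    Matrix.one_mulVec, dotProduct_sub, dotProduct_smul, smul_eq_mul, star_trivial] at this
  linarith

lemma dotProduct_le_mul_of_forall_spectrum (hM : M.IsHermitian) {b : ℝ}
    (hb : ∀ μ ∈ spectrum ℝ M, μ ≤ b) (y : Fin q → ℝ) : y ⬝ᵥ (M *ᵥ y) ≤ b * (y ⬝ᵥ y) := by
  have h := mul_dotProduct_le_of_forall_spectrum (M := -M) (a := -b) hM.neg (fun μ hμ => by
    rw [← spectrum.neg_eq, Set.mem_neg] at hμ
    linarith [hb _ hμ]) y
  simp only [Matrix.neg_mulVec, dotProduct_neg] at h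
  linarith

lemma sInf_spectrum_mul_norm_sq_le (hM : M.PosSemidef) (y : E q) :
    sInf (spectrum ℝ M) * ‖y‖ ^ 2 ≤ mnorm M y ^ 2 := by
  rw [mnorm_sq hM, norm_sq_eq_dotProduct]
  exact mul_dotProduct_le_of_forall_spectrum hM.1
    (fun μ hμ => csInf_le (finite_spectrum hM.1).bddBelow hμ) _

lemma mnorm_sq_le_sSup_spectrum_mul (hM : M.PosSemidef) (y : E q) :
    mnorm M y ^ 2 ≤ sSup (spectrum ℝ M) * ‖y‖ ^ 2 := by
  rw [mnorm_sq hM, norm_sq_eq_dotProduct]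
  exact dotProduct_le_mul_of_forall_spectrum hM.1
    (fun μ hμ => le_csSup (finite_spectrum hM.1).bddAbove hμ) _

lemma exists_eigenvector_of_mem_spectrum {μ : ℝ} (hμ : μ ∈ spectrum ℝ M) :
    ∃ y : E q, y ≠ 0 ∧ M *ᵥ y.ofLp = μ • y.ofLp := by
  rw [← Matrix.spectrum_toLin', ← Module.End.hasEigenvalue_iff_mem_spectrum] at hμ
  obtain ⟨y, hy⟩ := hμ.exists_hasEigenvector
  refine ⟨WithLp.toLp 2 y, fun h => hy.2 (by simpa using h), ?_⟩
  simpa using hy.apply_eq_smul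

lemma adaptiveMetric_dotProduct (ε₀ : ℝ) (u : ℕ → E q) (k : ℕ) (y : E q) :
    y.ofLp ⬝ᵥ (adaptiveMetric ε₀ u k *ᵥ y.ofLp) =
      ε₀ * ‖y‖ ^ 2 + 1 / (k : ℝ) * ∑ i ∈ Finset.range k, inner ℝ (u i) y ^ 2 := by
  rw [norm_sq_eq_dotProduct, adaptiveMetric, Matrix.add_mulVec, dotProduct_add,
    Matrix.smul_mulVec, Matrix.smul_mulVec, Matrix.one_mulVec, dotProduct_smul, dotProduct_smul,
    Matrix.sum_mulVec, dotProduct_sum]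
  simp only [smul_eq_mul]
  congr 2
  refine Finset.sum_congr rfl fun i _ => ?_
  rw [Matrix.vecMulVec_mulVec, inner_eq_dotProduct]
  simp [dotProduct_smul, sq, dotProduct_comm]

lemma adaptiveMetric_isHermitian (ε₀ : ℝ) (u : ℕ → E q) (k : ℕ) :
    (adaptiveMetric ε₀ u k).IsHermitian := by
  rw [Matrix.IsHermitian, adaptiveMetric]
  simp [Matrix.transpose_sum, Matrix.transpose_vecMulVec]

lemma mul_norm_sq_le_adaptiveMetric (ε₀ : ℝ) (u : ℕ → E q) (k : ℕ) (y : E q) :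
    ε₀ * ‖y‖ ^ 2 ≤ y.ofLp ⬝ᵥ (adaptiveMetric ε₀ u k *ᵥ y.ofLp) := by
  rw [adaptiveMetric_dotProduct, le_add_iff_nonneg_right]
  positivity

lemma adaptiveMetric_le_mul_norm_sq (ε₀ : ℝ) {u : ℕ → E q} (hu : ∀ i, ‖u i‖ = 1) (k : ℕ)
    (y : E q) : y.ofLp ⬝ᵥ (adaptiveMetric ε₀ u k *ᵥ y.ofLp) ≤ (ε₀ + 1) * ‖y‖ ^ 2 := by
  have h : ∑ i ∈ Finset.range k, inner ℝ (u i) y ^ 2 ≤ k * ‖y‖ ^ 2 := by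
    calc _ ≤ ∑ i ∈ Finset.range k, ‖y‖ ^ 2 := Finset.sum_le_sum fun i _ => by
          have := abs_real_inner_le_norm (u i) y
          rw [hu, one_mul] at this
          exact sq_le_sq' (abs_le.mp this).1 (abs_le.mp this).2
      _ = _ := by simp
  rw [adaptiveMetric_dotProduct, add_mul, one_mul]
  gcongr
  -- For `k = 0` the factor `1 / 0` is `0`, which matches `M_0 = ε₀ I`.
  rcases Nat.eq_zero_or_pos k with rfl | hk
  · simp
  · rw [one_div, inv_mul_le_iff₀ (by exact_mod_cast hk)]
    exact h

lemma adaptiveMetric_posSemidef {ε₀ : ℝ} (hε : 0 < ε₀) (u : ℕ → E q) (k : ℕ) :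
    (adaptiveMetric ε₀ u k).PosSemidef :=
  .of_dotProduct_mulVec_nonneg (adaptiveMetric_isHermitian ε₀ u k) fun y =>
    le_trans (by positivity) (mul_norm_sq_le_adaptiveMetric ε₀ u k (WithLp.toLp 2 y))

lemma spectrum_adaptiveMetric_subset (ε₀ : ℝ) {u : ℕ → E q} (hu : ∀ i, ‖u i‖ = 1) (k : ℕ) :
    spectrum ℝ (adaptiveMetric ε₀ u k) ⊆ Set.Icc ε₀ (ε₀ + 1) := by
  intro μ hμ
  obtain ⟨y, hy0, hy⟩ := exists_eigenvector_of_mem_spectrum hμ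
  have hpos : 0 < ‖y‖ ^ 2 := by positivity
  have h1 := mul_norm_sq_le_adaptiveMetric ε₀ u k y
  have h2 := adaptiveMetric_le_mul_norm_sq ε₀ hu k y
  rw [hy, dotProduct_smul, smul_eq_mul, ← norm_sq_eq_dotProduct] at h1 h2
  exact ⟨le_of_mul_le_mul_right h1 hpos, le_of_mul_le_mul_right h2 hpos⟩

lemma spectrum_nonempty_of_isHermitian (hq : 0 < q) (hM : M.IsHermitian) :
    (spectrum ℝ M).Nonempty :=
  ⟨_, hM.eigenvalues_mem_spectrum_real ⟨0, hq⟩⟩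

lemma le_sInf_spectrum_adaptiveMetric (hq : 0 < q) (ε₀ : ℝ) {u : ℕ → E q}
    (hu : ∀ i, ‖u i‖ = 1) (k : ℕ) : ε₀ ≤ sInf (spectrum ℝ (adaptiveMetric ε₀ u k)) :=
  le_csInf (spectrum_nonempty_of_isHermitian hq (adaptiveMetric_isHermitian ε₀ u k))
    fun _ hμ => (spectrum_adaptiveMetric_subset ε₀ hu k hμ).1

lemma sInf_spectrum_le_sSup_spectrum (hq : 0 < q) (hM : M.IsHermitian) :
    sInf (spectrum ℝ M) ≤ sSup (spectrum ℝ M) :=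
  csInf_le_csSup (spectrum_nonempty_of_isHermitian hq hM) (finite_spectrum hM).bddBelow
    (finite_spectrum hM).bddAbove

lemma one_le_condNumber (hq : 0 < q) (hM : M.IsHermitian) (h : 0 < sInf (spectrum ℝ M)) :
    1 ≤ condNumber M := by
  rw [condNumber, one_le_div h]
  exact sInf_spectrum_le_sSup_spectrum hq hM

lemma condNumber_adaptiveMetric_le (hq : 0 < q) {ε₀ : ℝ} (hε : 0 < ε₀) {u : ℕ → E q}
    (hu : ∀ i, ‖u i‖ = 1) (k : ℕ) : condNumber (adaptiveMetric ε₀ u k) ≤ (ε₀ + 1) / ε₀ :=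
  div_le_div₀ (by positivity)
    (csSup_le (spectrum_nonempty_of_isHermitian hq (adaptiveMetric_isHermitian ε₀ u k))
      fun _ hμ => (spectrum_adaptiveMetric_subset ε₀ hu k hμ).2) hε
    (le_sInf_spectrum_adaptiveMetric hq ε₀ hu k)

end Metric

/-! ### Geometry of the upper image and of its slice -/

namespace Problem

variable {n q : ℕ} (p : Problem n q)

lemma zero_mem_cone : (0 : E q) ∈ p.C := by
  obtain ⟨N, a, h⟩ := p.cone_polyhedral
  simp [h]

lemma add_mem_cone {c d : E q} (hc : c ∈ p.C) (hd : d ∈ p.C) : c + d ∈ p.C := by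
  obtain ⟨N, a, h⟩ := p.cone_polyhedral
  rw [h] at hc hd ⊢
  intro i
  rw [inner_add_right]
  exact add_nonneg (hc i) (hd i)

lemma smul_mem_cone {c : E q} (hc : c ∈ p.C) {t : ℝ} (ht : 0 ≤ t) : t • c ∈ p.C := by
  obtain ⟨N, a, h⟩ := p.cone_polyhedral
  rw [h] at hc ⊢
  intro i
  rw [real_inner_smul_right]
  exact mul_nonneg ht (hc i)

lemma isClosed_cone : IsClosed p.C := by
  obtain ⟨N, a, h⟩ := p.cone_polyhedral
  rw [h, Set.ofPred_forall]
  exact isClosed_iInter fun i => isClosed_le continuous_const (by fun_prop)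

lemma mem_dualCone {w : E q} : w ∈ p.dualCone ↔ ∀ c ∈ p.C, 0 ≤ inner ℝ w c := by
  simp only [dualCone, SetLike.mem_coe, ProperCone.mem_innerDual]
  exact forall₂_congr fun c _ => by rw [real_inner_comm]

/-- Since `w̄` is interior to the dual cone, `w̄` minus a short multiple of `c` is still in it; pair
that vector with `c`. This bound is what makes the slice bounded. -/
lemma exists_pos_mul_norm_le_inner_wbar :
    ∃ δ : ℝ, 0 < δ ∧ ∀ c ∈ p.C, δ * ‖c‖ ≤ inner ℝ p.wbar c := by
  obtain ⟨δ, hδ, hb⟩ := Metric.isOpen_iff.mp isOpen_interior _ p.wbar_mem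
  refine ⟨δ / 2, by positivity, fun c hc => ?_⟩
  rcases eq_or_ne c 0 with rfl | h0
  · simp
  have hn : 0 < ‖c‖ := norm_pos_iff.mpr h0
  have hmem : p.wbar - (δ / 2 / ‖c‖) • c ∈ p.dualCone := by
    refine interior_subset (hb ?_)
    rw [Metric.mem_ball, dist_eq_norm, sub_sub_cancel_left, norm_neg, norm_smul, Real.norm_eq_abs,
      abs_of_pos (by positivity), div_mul_cancel₀ _ hn.ne']
    linarith
  have := p.mem_dualCone.mp hmem c hc
  rw [inner_sub_left, real_inner_smul_left, real_inner_self_eq_norm_sq] at this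
  have h2 : δ / 2 / ‖c‖ * ‖c‖ ^ 2 = δ / 2 * ‖c‖ := by field_simp
  linarith

lemma exists_mem_cone_ne_zero : ∃ c ∈ p.C, c ≠ 0 := by
  by_contra! h
  exact p.cone_ne_zero (Set.eq_singleton_iff_unique_mem.mpr ⟨p.zero_mem_cone, h⟩)

lemma exists_mem_cone_inner_wbar_pos : ∃ c ∈ p.C, 0 < inner ℝ p.wbar c := by
  obtain ⟨c, hc, h0⟩ := p.exists_mem_cone_ne_zero
  obtain ⟨δ, hδ, h⟩ := p.exists_pos_mul_norm_le_inner_wbar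
  exact ⟨c, hc, lt_of_lt_of_le (by positivity) (h c hc)⟩

lemma wbar_ne_zero : p.wbar ≠ 0 := by
  obtain ⟨c, -, h⟩ := p.exists_mem_cone_inner_wbar_pos
  rintro h0
  simp [h0] at h

/-- A small step from `Γ x` along `w̄` stays in the cap. The strict inequality serves as the Slater
condition for the multiplier of the cap. -/
lemma inner_wbar_lt {x : E n} (hx : x ∈ p.X) : inner ℝ p.wbar (p.Γ x) < p.γ := by
  obtain ⟨δ, hδ, hb⟩ := Metric.isOpen_iff.mp isOpen_interior _ (p.image_subset ⟨x, hx, rfl⟩)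
  have hn : 0 < ‖p.wbar‖ := norm_pos_iff.mpr p.wbar_ne_zero
  have hmem : p.Γ x + (δ / 2 / ‖p.wbar‖) • p.wbar ∈ capHalfspace p.wbar p.γ := by
    refine interior_subset (hb ?_)
    rw [Metric.mem_ball, dist_eq_norm, add_sub_cancel_left, norm_smul, Real.norm_eq_abs,
      abs_of_pos (by positivity), div_mul_cancel₀ _ hn.ne']
    linarith
  rw [capHalfspace, Set.mem_ofPred_eq, inner_add_right, real_inner_smul_right,
    real_inner_self_eq_norm_sq] at hmem
  have : 0 < δ / 2 / ‖p.wbar‖ * ‖p.wbar‖ ^ 2 := by positivity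
  linarith

lemma image_mem_upperImage {x : E n} (hx : x ∈ p.X) : p.Γ x ∈ p.upperImage :=
  ⟨x, hx, 0, p.zero_mem_cone, by simp⟩

lemma add_mem_upperImage {y c : E q} (hy : y ∈ p.upperImage) (hc : c ∈ p.C) :
    y + c ∈ p.upperImage := by
  obtain ⟨x, hx, d, hd, rfl⟩ := hy
  exact ⟨x, hx, d + c, p.add_mem_cone hd hc, by abel⟩

lemma convex_upperImage : Convex ℝ p.upperImage := by
  rintro _ ⟨x₁, hx₁, c₁, hc₁, rfl⟩ _ ⟨x₂, hx₂, c₂, hc₂, rfl⟩ a b ha hb hab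
  obtain rfl : b = 1 - a := by linarith
  refine ⟨a • x₁ + (1 - a) • x₂, p.X_convex hx₁ hx₂ ha hb hab, _,
    p.add_mem_cone (p.add_mem_cone (p.smul_mem_cone hc₁ ha) (p.smul_mem_cone hc₂ hb))
      (p.Γ_convex x₁ hx₁ x₂ hx₂ a ha (by linarith)), ?_⟩
  simp only [smul_add]
  abel

open scoped Pointwise in
lemma upperImage_eq_add : p.upperImage = p.Γ '' p.X + p.C := by
  ext y
  simp only [upperImage, Set.mem_ofPred_eq, Set.mem_add, Set.exists_mem_image, eq_comm]

lemma isCompact_image : IsCompact (p.Γ '' p.X) :=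
  p.X_compact.image_of_continuousOn p.Γ_continuous

open scoped Pointwise in
lemma isClosed_upperImage : IsClosed p.upperImage := by
  rw [upperImage_eq_add]
  exact p.isClosed_cone.add_left_of_isCompact p.isCompact_image

lemma isClosed_capHalfspace (w : E q) (γ : ℝ) : IsClosed (capHalfspace w γ) :=
  isClosed_le (by fun_prop) continuous_const

lemma convex_capHalfspace (w : E q) (γ : ℝ) : Convex ℝ (capHalfspace w γ) :=
  convex_halfSpace_le ⟨fun _ _ => inner_add_right _ _ _, fun _ _ => real_inner_smul_right _ _ _⟩ γ

lemma convex_slice : Convex ℝ p.slice :=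
  p.convex_upperImage.inter (convex_capHalfspace _ _)

lemma image_mem_slice {x : E n} (hx : x ∈ p.X) : p.Γ x ∈ p.slice :=
  ⟨p.image_mem_upperImage hx, (p.inner_wbar_lt hx).le⟩

lemma slice_nonempty : p.slice.Nonempty :=
  let ⟨_, hx⟩ := p.X_nonempty
  ⟨_, p.image_mem_slice hx⟩

lemma isBounded_slice : Bornology.IsBounded p.slice := by
  obtain ⟨δ, hδ, h⟩ := p.exists_pos_mul_norm_le_inner_wbar
  obtain ⟨B, hB⟩ := p.isCompact_image.isBounded.exists_norm_le
  refine isBounded_iff_forall_norm_le.mpr ⟨B + (p.γ + ‖p.wbar‖ * B) / δ, ?_⟩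
  rintro _ ⟨⟨x, hx, c, hc, rfl⟩, hγ⟩
  have hx' := hB _ ⟨x, hx, rfl⟩
  refine (norm_add_le _ _).trans (add_le_add hx' ?_)
  rw [le_div_iff₀ hδ]
  rw [capHalfspace, Set.mem_ofPred_eq, inner_add_right] at hγ
  have h1 := h c hc
  have h2 := (abs_le.mp (abs_real_inner_le_norm p.wbar (p.Γ x))).1
  have h3 := mul_le_mul_of_nonneg_left hx' (norm_nonneg p.wbar)
  linarith

lemma isCompact_slice : IsCompact p.slice :=
  Metric.isCompact_of_isClosed_isBounded
    (p.isClosed_upperImage.inter (isClosed_capHalfspace _ _)) p.isBounded_slice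

/-- From some `Γ x`, strictly below the level `γ`, a short step in an interior direction of the cone
stays strictly below `γ` and enters the interior of `Γ x + C`. -/
lemma interior_slice_nonempty : (interior p.slice).Nonempty := by
  obtain ⟨x, hx⟩ := p.X_nonempty
  obtain ⟨c, hc⟩ := p.cone_solid
  have hx' := p.inner_wbar_lt hx
  have hopen : IsOpen {t : ℝ | inner ℝ p.wbar (p.Γ x + t • c) < p.γ} :=
    isOpen_lt (by fun_prop) continuous_const
  obtain ⟨δ, hδ, hb⟩ := Metric.isOpen_iff.mp hopen 0 (by simpa using hx')
  have ht : inner ℝ p.wbar (p.Γ x + (δ / 2) • c) < p.γ :=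
    hb (by rw [Metric.mem_ball, dist_zero_right, Real.norm_eq_abs, abs_of_pos] <;> linarith)
  let U : Set (E q) := (fun y => (δ / 2)⁻¹ • (y - p.Γ x)) ⁻¹' interior p.C ∩
    {y | inner ℝ p.wbar y < p.γ}
  have hU : IsOpen U := (isOpen_interior.preimage (by fun_prop)).inter
    (isOpen_lt (by fun_prop) continuous_const)
  refine ⟨p.Γ x + (δ / 2) • c, interior_maximal ?_ hU ⟨?_, ht⟩⟩
  · rintro y ⟨h1, h2⟩
    refine ⟨⟨x, hx, y - p.Γ x, ?_, by abel⟩, show inner ℝ p.wbar y ≤ p.γ from le_of_lt h2⟩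
    have := p.smul_mem_cone (interior_subset h1) (half_pos hδ).le
    rwa [smul_inv_smul₀ (half_pos hδ).ne'] at this
  · simpa [smul_smul, hδ.ne'] using hc

lemma exists_primalFeasible_iff {v z : E q} :
    (∃ x, p.PrimalFeasible v x z) ↔ v + z ∈ p.slice := by
  constructor
  · rintro ⟨x, hx, hc, hγ⟩
    exact ⟨⟨x, hx, _, hc, by abel⟩, hγ⟩
  · rintro ⟨⟨x, hx, c, hc, h⟩, hγ⟩
    exact ⟨x, hx, by rwa [h, add_sub_cancel_left], hγ⟩

/-- The cap is tight: moving from `Γ x` along a nonzero cone direction reaches the level `γ` without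
leaving the upper image. -/
lemma capHalfspace_eq_suppHalfspace :
    capHalfspace p.wbar p.γ = suppHalfspace (-p.wbar) p.slice := by
  have h : supportFn p.slice (-p.wbar) = -p.γ := by
    obtain ⟨x, hx⟩ := p.X_nonempty
    obtain ⟨c, hc, hpos⟩ := p.exists_mem_cone_inner_wbar_pos
    have hlt := p.inner_wbar_lt hx
    refine IsLeast.csInf_eq ⟨⟨p.Γ x + ((p.γ - inner ℝ p.wbar (p.Γ x)) / inner ℝ p.wbar c) • c,
      ⟨p.add_mem_upperImage (p.image_mem_upperImage hx)
        (p.smul_mem_cone hc (div_nonneg (by linarith) hpos.le)), ?_⟩, ?_⟩, ?_⟩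
    · rw [capHalfspace, Set.mem_ofPred_eq, inner_add_right, real_inner_smul_right,
        div_mul_cancel₀ _ hpos.ne']
      linarith
    · simp only [inner_neg_left]
      rw [inner_add_right, real_inner_smul_right, div_mul_cancel₀ _ hpos.ne']
      linarith
    · rintro _ ⟨y, hy, rfl⟩
      simp only [inner_neg_left]
      exact neg_le_neg hy.2
  ext y
  simp [capHalfspace, suppHalfspace, h]

end Problem

/-! ### Duality for the scalarization -/

section Duality

variable {n q : ℕ}

/-- Lagrange multiplier for the minimization of a linear functional over a convex set under one
linear constraint satisfying the Slater condition. -/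
lemma exists_multiplier {P : Set (E q)} (hP : Convex ℝ P) (g w : E q) (m γ : ℝ)
    (hf : ∀ y ∈ P, inner ℝ w y ≤ γ → m ≤ inner ℝ g y) {y₀ : E q} (hy₀ : y₀ ∈ P)
    (hlt : inner ℝ w y₀ < γ) :
    ∃ l : ℝ, 0 ≤ l ∧ ∀ y ∈ P, m ≤ inner ℝ g y + l * (inner ℝ w y - γ) := by
  -- Strictly feasible points bound an admissible multiplier from above by these quotients, and
  -- infeasible points bound it from below. The infimum is the largest candidate.
  set S : Set ℝ := (fun y => (inner ℝ g y - m) / (γ - inner ℝ w y)) '' {y ∈ P | inner ℝ w y < γ}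
    with hS
  have hne : S.Nonempty := ⟨_, y₀, ⟨hy₀, hlt⟩, rfl⟩
  have hnn : ∀ s ∈ S, 0 ≤ s := by
    rintro _ ⟨y, ⟨hy, hyγ⟩, rfl⟩
    exact div_nonneg (by linarith [hf y hy hyγ.le]) (by linarith)
  refine ⟨sInf S, Real.sInf_nonneg hnn, fun y hy => ?_⟩
  rcases lt_trichotomy (inner ℝ w y) γ with h | h | h
  · have : sInf S ≤ (inner ℝ g y - m) / (γ - inner ℝ w y) := csInf_le ⟨0, hnn⟩ ⟨y, ⟨hy, h⟩, rfl⟩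
    rw [le_div_iff₀ (by linarith)] at this
    linarith
  · have := hf y hy h.le
    rw [h]
    linarith
  · have : (m - inner ℝ g y) / (inner ℝ w y - γ) ≤ sInf S := by
      refine le_csInf hne ?_
      rintro _ ⟨y', ⟨hy', hyγ'⟩, rfl⟩
      set a := inner ℝ w y - γ with ha
      set b := γ - inner ℝ w y' with hb
      have hapos : 0 < a := by linarith
      have hbpos : 0 < b := by linarith
      -- The weights place the combination exactly on the hyperplane at level `γ`, where `hf`
      -- applies.
      have hmem : (b / (a + b)) • y + (a / (a + b)) • y' ∈ P :=
        hP hy hy' (by positivity) (by positivity) (by field_simp; ring)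
      have h1 : inner ℝ w ((b / (a + b)) • y + (a / (a + b)) • y') = γ := by
        rw [inner_add_right, real_inner_smul_right, real_inner_smul_right,
          show inner ℝ w y = γ + a by linarith, show inner ℝ w y' = γ - b by linarith]
        field_simp
        ring
      have h2 := hf _ hmem h1.le
      rw [inner_add_right, real_inner_smul_right, real_inner_smul_right] at h2
      have h3 : m * (a + b) ≤ b * inner ℝ g y + a * inner ℝ g y' := by
        calc m * (a + b) ≤ (b / (a + b) * inner ℝ g y + a / (a + b) * inner ℝ g y') * (a + b) :=
              mul_le_mul_of_nonneg_right h2 (by linarith)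
          _ = _ := by field_simp
      simp only
      rw [← hb, div_le_div_iff₀ hapos hbpos]
      linarith
    rw [div_le_iff₀ (by linarith)] at this
    linarith

/-- A separating functional at the point of a convex set minimizing the seminorm `‖L (y - v)‖`. -/
lemma exists_dual_certificate (L : E q →L[ℝ] E q) {A : Set (E q)} (hA : Convex ℝ A) {v z₀ : E q}
    (hz₀ : v + z₀ ∈ A) (hmin : ∀ y ∈ A, ‖L z₀‖ ≤ ‖L (y - v)‖) :
    ∃ g : E q, (∀ z, inner ℝ g z ≤ ‖L z‖) ∧ ∀ y ∈ A, ‖L z₀‖ ≤ inner ℝ g (y - v) := by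
  rcases eq_or_ne (L z₀) 0 with h0 | h0
  · exact ⟨0, by simp, by simp [h0]⟩
  have hpos : 0 < ‖L z₀‖ := norm_pos_iff.mpr h0
  have hinner : ∀ z, inner ℝ (‖L z₀‖⁻¹ • ContinuousLinearMap.adjoint L (L z₀)) z =
      ‖L z₀‖⁻¹ * inner ℝ (L z₀) (L z) := fun z => by
    rw [real_inner_smul_left, ContinuousLinearMap.adjoint_inner_left]
  -- This is the gradient of `‖L ·‖` at `z₀`. The first bound is Cauchy–Schwarz, the second the
  -- variational inequality for projecting `0` onto the convex set `L (A - v)`.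
  refine ⟨‖L z₀‖⁻¹ • ContinuousLinearMap.adjoint L (L z₀), fun z => ?_, fun y hy => ?_⟩
  · rw [hinner, inv_mul_le_iff₀ hpos]
    exact real_inner_le_norm _ _
  · rw [hinner, le_inv_mul_iff₀ hpos]
    have hK : Convex ℝ ((fun y => L (y - v)) '' A) := by
      have := (hA.translate (-v)).linear_image L.toLinearMap
      rw [Set.image_image] at this
      simpa [sub_eq_neg_add] using this
    have hmem : L z₀ ∈ (fun y => L (y - v)) '' A := ⟨_, hz₀, by simp⟩
    have : Nonempty ((fun y => L (y - v)) '' A) := ⟨⟨_, hmem⟩⟩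
    have key := (norm_eq_iInf_iff_real_inner_le_zero hK (u := 0) hmem).mp (by
      refine le_antisymm (le_ciInf ?_) (ciInf_le_of_le ⟨0, ?_⟩ ⟨_, hmem⟩ le_rfl)
      · rintro ⟨_, y', hy', rfl⟩
        simpa only [zero_sub, norm_neg] using hmin y' hy'
      · rintro _ ⟨_, rfl⟩
        exact norm_nonneg _) _ ⟨y, hy, rfl⟩
    simp only [zero_sub, inner_neg_left, inner_sub_right, real_inner_self_eq_norm_sq] at key
    linarith

variable (p : Problem n q) {M : Matrix (Fin q) (Fin q) ℝ}

lemma mnorm_zero : mnorm M 0 = 0 := by simp [mnorm]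

/-- Grouping by `z` isolates the term whose infimum over `z` is `0` if the cut-normal is in the dual
unit ball and `-∞` otherwise. -/
lemma Problem.lagrangian_eq (v : E q) (x : E n) (z w : E q) (l : ℝ) :
    p.lagrangian M v x z w l = (mnorm M z - inner ℝ (w - l • p.wbar) z) +
      (inner ℝ w (p.Γ x) - inner ℝ (w - l • p.wbar) v - l * p.γ) := by
  simp only [Problem.lagrangian, inner_sub_left, inner_sub_right, inner_add_right,
    real_inner_smul_left]
  ring

/-- Strong duality: the optimal value of the scalarization bounds the dual optimal value below. -/
lemma Problem.mnorm_le_dualObjective (hM : M.PosSemidef) {v w : E q} {l : ℝ} {x : E n} {z : E q}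
    (hp : p.IsPrimalOptimal M v x z) (hd : p.IsDualOptimal M v w l) :
    ((mnorm M z : ℝ) : EReal) ≤ p.dualObjective M v w l := by
  obtain ⟨L, hL⟩ := exists_clm_norm_eq_mnorm hM
  obtain ⟨g, hg1, hg2⟩ := exists_dual_certificate L p.convex_slice
    (p.exists_primalFeasible_iff.mp ⟨x, hp.1⟩) (fun y hy => by
      obtain ⟨x', hx'⟩ := p.exists_primalFeasible_iff (v := v) (z := y - v) |>.mpr (by simpa)
      rw [← hL, ← hL]
      exact hp.2 _ _ hx')
  obtain ⟨x₀, hx₀⟩ := p.X_nonempty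
  obtain ⟨l', hl', hP⟩ := exists_multiplier p.convex_upperImage g p.wbar
    (‖L z‖ + inner ℝ g v) p.γ (fun y hy hyγ => by
      have := hg2 y ⟨hy, hyγ⟩
      rw [inner_sub_right] at this
      linarith) (p.image_mem_upperImage hx₀) (p.inner_wbar_lt hx₀)
  -- If the functional were negative on some `c`, then `hP` would fail far along the ray `Γ x₀ + t
  -- c`; `t = (B - 1) / a` violates it by exactly `1`.
  have hw' : g + l' • p.wbar ∈ p.dualCone := by
    rw [p.mem_dualCone]
    intro c hc
    by_contra! hneg
    set a := inner ℝ (g + l' • p.wbar) c with ha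
    set B := ‖L z‖ + inner ℝ g v - (inner ℝ g (p.Γ x₀) + l' * (inner ℝ p.wbar (p.Γ x₀) - p.γ))
      with hB
    have hBle : B ≤ 0 := by linarith [hP _ (p.image_mem_upperImage hx₀)]
    have h1 := hP _ (p.add_mem_upperImage (p.image_mem_upperImage hx₀)
      (p.smul_mem_cone hc (t := (B - 1) / a) (div_nonneg_of_nonpos (by linarith) hneg.le)))
    have h2 : (B - 1) / a * (inner ℝ g c + l' * inner ℝ p.wbar c) = B - 1 := by
      rw [ha, inner_add_left, real_inner_smul_left, div_mul_cancel₀]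
      rw [ha, inner_add_left, real_inner_smul_left] at hneg
      exact hneg.ne
    simp only [inner_add_right, real_inner_smul_right] at h1
    linarith
  refine le_trans ?_ (hd.2.2 _ hw' l' hl')
  refine le_iInf₂ fun x' hx' => le_iInf fun z' => ?_
  rw [EReal.coe_le_coe_iff, p.lagrangian_eq, add_sub_cancel_right, hL, hL, inner_add_left,
    real_inner_smul_left]
  linarith [hg1 z', hP _ (p.image_mem_upperImage hx')]

/-- The cut-normal of a dual solution separates the slice from the `M`-ball around `v` and lies in
the unit ball of the dual norm. -/
lemma Problem.cut_normal_properties (hM : M.PosSemidef) {v w : E q} {l : ℝ} {x : E n} {z : E q}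
    (hp : p.IsPrimalOptimal M v x z) (hd : p.IsDualOptimal M v w l) :
    (∀ y ∈ p.slice, mnorm M z ≤ inner ℝ (w - l • p.wbar) (y - v)) ∧
      ∀ z', inner ℝ (w - l • p.wbar) z' ≤ mnorm M z' := by
  obtain ⟨L, hL⟩ := exists_clm_norm_eq_mnorm hM
  -- The dual bound at `Γ x'` passes to `Γ x' + c`: dual feasibility and the cap constraint give the
  -- discarded terms the right sign.
  have hD : ∀ y ∈ p.slice, ∀ z', mnorm M z ≤
      (mnorm M z' - inner ℝ (w - l • p.wbar) z') + inner ℝ (w - l • p.wbar) (y - v) := by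
    rintro _ ⟨⟨x', hx', c, hc, rfl⟩, hγ⟩ z'
    have h := p.mnorm_le_dualObjective hM hp hd
    have h1 := EReal.coe_le_coe_iff.mp ((le_iInf₂_iff.mp h x' hx').trans (iInf_le _ z'))
    rw [p.lagrangian_eq] at h1
    have h2 := p.mem_dualCone.mp hd.1 c hc
    have h3 := mul_le_mul_of_nonneg_left (show inner ℝ p.wbar (p.Γ x' + c) ≤ p.γ from hγ) hd.2.1
    rw [inner_sub_right, inner_sub_left _ _ (p.Γ x' + c), real_inner_smul_left,
      inner_add_right w]
    linarith
  refine ⟨fun y hy => by simpa [mnorm_zero] using hD y hy 0, fun z' => ?_⟩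
  obtain ⟨y, hy⟩ := p.slice_nonempty
  by_contra! hlt
  set g := w - l • p.wbar
  -- A violation at `z'` would scale linearly along its ray, but the right-hand side does not depend
  -- on `t`.
  have hscale : ∀ t : ℝ, 0 ≤ t → t * (inner ℝ g z' - mnorm M z') ≤ inner ℝ g (y - v) := by
    intro t ht
    have := hD y hy (t • z')
    rw [hL (t • z'), map_smul, norm_smul, Real.norm_of_nonneg ht, real_inner_smul_right,
      ← hL] at this
    have h0 : 0 ≤ mnorm M z := Real.sqrt_nonneg _
    linarith
  have hpos : 0 < inner ℝ g z' - mnorm M z' := by linarith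
  have h0 := hscale 0 le_rfl
  have h1 := hscale ((inner ℝ g (y - v) + 1) / (inner ℝ g z' - mnorm M z'))
    (div_nonneg (by linarith) hpos.le)
  rw [div_mul_cancel₀ _ hpos.ne'] at h1
  linarith

/-- One inequality is the dual-ball bound, the other is separation tested at `v + z`, itself a point
of the slice. Hence the cutting hyperplane touches the slice there. -/
lemma Problem.inner_cut_normal_eq (hM : M.PosSemidef) {v w : E q} {l : ℝ} {x : E n} {z : E q}
    (hp : p.IsPrimalOptimal M v x z) (hd : p.IsDualOptimal M v w l) :
    inner ℝ (w - l • p.wbar) z = mnorm M z := by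
  obtain ⟨h1, h2⟩ := p.cut_normal_properties hM hp hd
  refine le_antisymm (h2 z) ?_
  simpa using h1 _ (p.exists_primalFeasible_iff.mp ⟨x, hp.1⟩)

lemma Problem.supportFn_cut_normal (hM : M.PosSemidef) {v w : E q} {l : ℝ} {x : E n} {z : E q}
    (hp : p.IsPrimalOptimal M v x z) (hd : p.IsDualOptimal M v w l) :
    supportFn p.slice (w - l • p.wbar) = inner ℝ (w - l • p.wbar) (v + z) := by
  refine IsLeast.csInf_eq ⟨⟨_, p.exists_primalFeasible_iff.mp ⟨x, hp.1⟩, rfl⟩, ?_⟩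
  rintro _ ⟨y, hy, rfl⟩
  have := (p.cut_normal_properties hM hp hd).1 y hy
  rw [inner_sub_right] at this
  simp only
  rw [inner_add_right, p.inner_cut_normal_eq hM hp hd]
  linarith

lemma Problem.norm_cut_normal_le (hM : M.PosSemidef) {v w : E q} {l : ℝ} {x : E n} {z : E q}
    (hp : p.IsPrimalOptimal M v x z) (hd : p.IsDualOptimal M v w l) :
    ‖w - l • p.wbar‖ ≤ √(sSup (spectrum ℝ M)) := by
  set g := w - l • p.wbar with hg
  -- Testing the dual-ball bound at `g` itself gives `‖g‖² ≤ ‖g‖_M ≤ √λ_max ‖g‖`.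
  have h1 := (p.cut_normal_properties hM hp hd).2 g
  rw [← hg, real_inner_self_eq_norm_sq] at h1
  have h2 := mnorm_sq_le_sSup_spectrum_mul hM g
  rcases (norm_nonneg g).eq_or_lt with h0 | h0
  · rw [← h0]
    exact Real.sqrt_nonneg _
  refine Real.le_sqrt_of_sq_le (le_of_mul_le_mul_right (h2.trans' ?_) (by positivity : 0 < ‖g‖ ^ 2))
  rw [← sq]
  exact pow_le_pow_left₀ (by positivity) h1 2

end Duality

/-! ### A packing bound -/

section Packing

open MeasureTheory Metric

variable {q : ℕ}

lemma one_add_pow_le {s : ℝ} (hs : 0 ≤ s) (d : ℕ) : (1 + s) ^ d ≤ 1 + d * s * (1 + s) ^ d := by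
  induction d with
  | zero => simp
  | succ d ih =>
    have h1 : (1 + s) ^ d ≤ (1 + s) ^ (d + 1) := pow_le_pow_right₀ (by linarith) (by omega)
    have h2 : (1 + s) ^ (d + 1) = (1 + s) ^ d + s * (1 + s) ^ d := by ring
    have h3 := mul_le_mul_of_nonneg_left h1 (by positivity : 0 ≤ ((d : ℝ) + 1) * s)
    push_cast
    linarith

/-- A parallel body of a convex body is contained in a dilate of it. -/
lemma cthickening_subset_homothety {A : Set (E q)} (hA : Convex ℝ A) (hc : IsCompact A)
    {a : E q} {ρ : ℝ} (hρ : 0 < ρ) (hb : closedBall a ρ ⊆ A) {t : ℝ} (ht : 0 ≤ t) :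
    cthickening t A ⊆ AffineMap.homothety a (1 + t / ρ) '' A := by
  rw [hc.cthickening_eq_biUnion_closedBall ht]
  refine Set.iUnion₂_subset fun b hbA y hy => ?_
  rw [mem_closedBall, dist_eq_norm] at hy
  rcases ht.eq_or_lt with rfl | htpos
  · obtain rfl : y = b := sub_eq_zero.mp (norm_le_zero_iff.mp hy)
    exact ⟨y, hbA, by simp⟩
  have hs : 0 < t / ρ := by positivity
  -- Rescaling `y - b` to length at most `ρ` lands in the inscribed ball. A convex combination of
  -- this point with `b` is the preimage of `y` under the dilation.
  have hmem : a + (ρ / t) • (y - b) ∈ A := by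
    refine hb ?_
    rw [mem_closedBall, dist_eq_norm, add_sub_cancel_left, norm_smul,
      Real.norm_of_nonneg (by positivity), div_mul_eq_mul_div, div_le_iff₀ htpos]
    exact mul_le_mul_of_nonneg_left hy hρ.le
  refine ⟨(1 + t / ρ)⁻¹ • b + (t / ρ / (1 + t / ρ)) • (a + (ρ / t) • (y - b)),
    hA hbA hmem (by positivity) (by positivity) (by field_simp), ?_⟩
  rw [AffineMap.homothety_apply, vsub_eq_sub, vadd_eq_add, smul_sub, smul_add, smul_smul, smul_smul,
    mul_inv_cancel₀ (by positivity), mul_div_cancel₀ _ (by positivity : 1 + t / ρ ≠ 0), smul_add,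
    smul_smul, div_mul_div_cancel₀ hρ.ne', div_self htpos.ne']
  module

/-- The enclosing dilate multiplies volume by `(1 + t/ρ)^q`, whose excess over `1` is linear in `t`
on bounded ranges. -/
lemma exists_volume_cthickening_le {A : Set (E q)} (hA : Convex ℝ A) (hc : IsCompact A)
    (hi : (interior A).Nonempty) (T : ℝ) :
    ∃ C : ℝ, 0 ≤ C ∧ ∀ t, 0 ≤ t → t ≤ T →
      volume.real (cthickening t A) ≤ volume.real A + C * t := by
  obtain ⟨a, ha⟩ := hi
  obtain ⟨ρ, hρ, hb⟩ := nhds_basis_closedBall.mem_iff.mp (mem_interior_iff_mem_nhds.mp ha)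
  refine ⟨q * ρ⁻¹ * (1 + |T| / ρ) ^ q * volume.real A, by positivity, fun t ht htT => ?_⟩
  have hfin : volume (AffineMap.homothety a (1 + t / ρ) '' A) ≠ ⊤ := by
    rw [Measure.addHaar_image_homothety]
    exact ENNReal.mul_ne_top ENNReal.ofReal_ne_top hc.measure_ne_top
  have hpow : (1 + t / ρ) ^ q ≤ (1 + |T| / ρ) ^ q := by
    gcongr
    exact htT.trans (le_abs_self T)
  calc volume.real (cthickening t A)
      ≤ volume.real (AffineMap.homothety a (1 + t / ρ) '' A) :=
        measureReal_mono (cthickening_subset_homothety hA hc hρ hb ht) hfin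
    _ = (1 + t / ρ) ^ q * volume.real A := by
        rw [measureReal_def, Measure.addHaar_image_homothety, ENNReal.toReal_mul,
          finrank_euclideanSpace_fin, ENNReal.toReal_ofReal (abs_nonneg _),
          abs_of_nonneg (by positivity), measureReal_def]
    _ ≤ (1 + q * (t / ρ) * (1 + |T| / ρ) ^ q) * volume.real A := by
        refine mul_le_mul_of_nonneg_right ?_ measureReal_nonneg
        refine (one_add_pow_le (by positivity) q).trans ?_
        gcongr
    _ = _ := by ring

/-- Volume comparison for separated points in a parallel body outside of the body. -/
lemma card_mul_volume_ball_le {A : Set (E q)} (hc : IsCompact A) (hA : A.Nonempty) {ρ T : ℝ}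
    (hρ : 0 < ρ) {v : ℕ → E q} {S : Finset ℕ}
    (hsep : ∀ i ∈ S, ∀ j ∈ S, i < j → 2 * ρ ≤ dist (v i) (v j))
    (hlow : ∀ i ∈ S, ρ ≤ infDist (v i) A) (hup : ∀ i ∈ S, infDist (v i) A + ρ ≤ T) :
    S.card * (ρ ^ q * volume.real (ball (0 : E q) 1)) + volume.real A ≤
      volume.real (cthickening T A) := by
  have hdisj : Set.PairwiseDisjoint (S : Set ℕ) (fun i => ball (v i) ρ) := by
    intro i hi j hj hij
    rcases lt_or_gt_of_ne hij with h | h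
    · exact ball_disjoint_ball (by linarith [hsep i hi j hj h])
    · exact (ball_disjoint_ball (by linarith [hsep j hj i hi h])).symm
  have hball : ∀ i, volume.real (ball (v i) ρ) = ρ ^ q * volume.real (ball (0 : E q) 1) := by
    intro i
    rw [measureReal_def, Measure.addHaar_ball_of_pos _ _ hρ, ENNReal.toReal_mul,
      finrank_euclideanSpace_fin, ENNReal.toReal_ofReal (by positivity), measureReal_def]
  have hU : volume.real (⋃ i ∈ S, ball (v i) ρ) =
      S.card * (ρ ^ q * volume.real (ball (0 : E q) 1)) := by
    rw [measureReal_biUnion_finset hdisj (fun i _ => measurableSet_ball)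
      (fun i _ => measure_ball_lt_top.ne)]
    simp [hball]
  have hdA : Disjoint (⋃ i ∈ S, ball (v i) ρ) A := by
    rw [Set.disjoint_iUnion₂_left]
    intro i hi
    rw [Set.disjoint_left]
    intro y hy hyA
    have := infDist_le_dist_of_mem hyA (x := v i)
    rw [mem_ball'] at hy
    linarith [hlow i hi]
  have hfinU : volume (⋃ i ∈ S, ball (v i) ρ) ≠ ⊤ :=
    (measure_biUnion_lt_top S.finite_toSet fun i _ => measure_ball_lt_top).ne
  rw [← hU, ← measureReal_union hdA hc.measurableSet hfinU hc.measure_ne_top]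
  refine measureReal_mono (Set.union_subset (Set.iUnion₂_subset fun i hi y hy => ?_) ?_)
    hc.cthickening.measure_ne_top
  · obtain ⟨a, ha, hya⟩ := hc.exists_infDist_eq_dist hA y
    refine mem_cthickening_of_dist_le y a T A ha ?_
    rw [← hya]
    have := infDist_le_infDist_add_dist (s := A) (x := y) (y := v i)
    rw [mem_ball] at hy
    linarith [hup i hi]
  · exact self_subset_cthickening A

/-- The constant `c` bounds the decay of every nonincreasing sequence `e` for which there are points
`v i` at distance between `r * e i` and `e i` from `A` with `v i` at distance at least `r * e i`
from all later points. -/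
def IsRateConstant (r : ℝ) (A : Set (E q)) (c : ℝ) : Prop :=
  0 ≤ c ∧ ∀ (v : ℕ → E q) (e : ℕ → ℝ), Antitone e → (∀ i, 0 ≤ e i) →
    (∀ i j, i < j → r * e i ≤ dist (v i) (v j)) → (∀ i, r * e i ≤ infDist (v i) A) →
    (∀ i, infDist (v i) A ≤ e i) → ∀ ε : ℝ, 0 < ε → ∃ K : ℕ, ∀ k : ℕ, K ≤ k →
      e k ≤ (1 + ε) * c * (k : ℝ) ^ (1 / (1 - (q : ℝ)))

/-- The number of terms among the first `k` that are at least `ε`. -/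
def countGe (e : ℕ → ℝ) (k : ℕ) (ε : ℝ) : ℕ := ((Finset.range k).filter (ε ≤ e ·)).card

lemma countGe_eq_of_le {e : ℕ → ℝ} (he : Antitone e) {k m : ℕ} {ε : ℝ} (hkm : k ≤ m + 1)
    (h : ε ≤ e m) : countGe e k ε = k := by
  rw [countGe, Finset.filter_true_of_mem, Finset.card_range]
  intro i hi
  exact h.trans (he (by have := Finset.mem_range.mp hi; omega))

lemma countGe_le_add {e : ℕ → ℝ} (k : ℕ) {ε δ : ℝ} :
    countGe e k ε ≤ countGe e k δ +
      ((Finset.range k).filter (fun i => ε ≤ e i ∧ e i ≤ δ)).card := by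
  refine (Finset.card_le_card ?_).trans (Finset.card_union_le _ _)
  intro i hi
  simp only [Finset.mem_filter, Finset.mem_union] at hi ⊢
  rcases le_total δ (e i) with h | h
  · exact Or.inl ⟨hi.1, h⟩
  · exact Or.inr ⟨hi.1, hi.2, h⟩

/-- Summation of block counts over dyadic scales. -/
lemma countGe_mul_pow_le {e : ℕ → ℝ} {k d : ℕ} (hd : 1 ≤ d) {C : ℝ} (hC : 0 ≤ C)
    (hblock : ∀ ε, 0 < ε → ε ≤ 1 →
      (((Finset.range k).filter (fun i => ε ≤ e i ∧ e i ≤ 2 * ε)).card : ℝ) * ε ^ d ≤ C)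
    {ε : ℝ} (hε : 0 < ε) (hε1 : ε ≤ 1) :
    (countGe e k ε : ℝ) * ε ^ d ≤ countGe e k 1 * ε ^ d + 2 * C := by
  obtain ⟨n, hn⟩ : ∃ n : ℕ, 1 ≤ 2 ^ n * ε := by
    obtain ⟨n, hn⟩ := pow_unbounded_of_one_lt (1 / ε) (one_lt_two : (1 : ℝ) < 2)
    exact ⟨n, by rw [div_lt_iff₀ hε] at hn; exact hn.le⟩
  -- Here `n` is a number of doublings that suffices to carry `ε` up to `1`.
  induction n generalizing ε with
  | zero =>
    obtain rfl : ε = 1 := by linarith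
    linarith
  | succ n ih =>
    have hb := hblock ε hε hε1
    have hpow : 0 < ε ^ d := by positivity
    rcases le_total 1 (2 * ε) with h | h
    · have h1 : (countGe e k ε : ℝ) ≤ countGe e k 1 +
          ((Finset.range k).filter (fun i => ε ≤ e i ∧ e i ≤ 2 * ε)).card := by
        have h2 := countGe_le_add (e := e) k (ε := ε) (δ := 1)
        have h3 : ((Finset.range k).filter (fun i => ε ≤ e i ∧ e i ≤ 1)).card ≤
            ((Finset.range k).filter (fun i => ε ≤ e i ∧ e i ≤ 2 * ε)).card :=
          Finset.card_le_card (Finset.monotone_filter_right _ fun i _ hi => ⟨hi.1, hi.2.trans h⟩)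
        exact_mod_cast h2.trans (Nat.add_le_add_left h3 _)
      have := mul_le_mul_of_nonneg_right h1 hpow.le
      linarith
    · have h1 : (countGe e k ε : ℝ) ≤ countGe e k (2 * ε) +
          ((Finset.range k).filter (fun i => ε ≤ e i ∧ e i ≤ 2 * ε)).card := by
        exact_mod_cast countGe_le_add k
      have h2 := ih (ε := 2 * ε) (by positivity) h (by rw [pow_succ] at hn; linarith)
      rw [mul_pow] at h2
      have h2d : (2 : ℝ) ≤ 2 ^ d := by simpa using pow_le_pow_right₀ (one_le_two : (1 : ℝ) ≤ 2) hd
      -- Dividing by `2 ^ d ≥ 2` turns the inductive `2 * C` into at most `C`, leaving room for the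
      -- new block. This is where `d ≥ 1` enters.
      have h3 : (countGe e k (2 * ε) : ℝ) * ε ^ d ≤ countGe e k 1 * ε ^ d + C := by
        refine le_of_mul_le_mul_left (a := (2 : ℝ) ^ d) ?_ (by positivity)
        have := mul_le_mul_of_nonneg_right h2d hC
        linarith
      have := mul_le_mul_of_nonneg_right h1 hpow.le
      linarith

lemma eventually_le_of_sub_mul_pow_le {e : ℕ → ℝ} {d K₀ : ℕ} (hd : 1 ≤ d) {B : ℝ} (hB : 0 ≤ B)
    (h : ∀ k, K₀ < k → ((k : ℝ) - K₀) * e k ^ d ≤ B) (he : ∀ k, 0 ≤ e k) {ε : ℝ} (hε : 0 < ε) :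
    ∃ K : ℕ, ∀ k : ℕ, K ≤ k →
      e k ≤ (1 + ε) * B ^ (1 / (d : ℝ)) * (k : ℝ) ^ (1 / (1 - ((d + 1 : ℕ) : ℝ))) := by
  -- Beyond this threshold `k ≤ (1 + ε) (k - K₀)`, so the factor `1 + ε` absorbs the offset `K₀`.
  obtain ⟨N, hN⟩ := exists_nat_ge (K₀ * (1 + ε) / ε)
  refine ⟨max N (K₀ + 1), fun k hk => ?_⟩
  have hkN : (N : ℝ) ≤ k := by exact_mod_cast (le_max_left _ _).trans hk
  have hkK : K₀ < k := (le_max_right _ _).trans hk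
  have hk0 : (0 : ℝ) < k := by exact_mod_cast (Nat.zero_le _).trans_lt hkK
  have hd0 : (d : ℝ) ≠ 0 := by positivity
  have h1 : (k : ℝ) ≤ (1 + ε) * (k - K₀) := by
    have := hN.trans hkN
    rw [div_le_iff₀ hε] at this
    linarith
  have h2 : (1 + ε) ≤ (1 + ε) ^ d := le_self_pow₀ (by linarith) (by omega)
  have hsub : (0 : ℝ) ≤ k - K₀ := by
    have : (K₀ : ℝ) < k := by exact_mod_cast hkK
    linarith
  refine le_of_pow_le_pow_left₀ (n := d) (by omega) (by positivity) ?_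
  rw [mul_pow, mul_pow, ← Real.rpow_natCast (B ^ _), ← Real.rpow_mul hB, one_div_mul_cancel hd0,
    Real.rpow_one, ← Real.rpow_natCast ((k : ℝ) ^ _), ← Real.rpow_mul hk0.le,
    show 1 / (1 - ((d + 1 : ℕ) : ℝ)) * (d : ℝ) = -1 by
      push_cast
      rw [sub_add_cancel_right, one_div, inv_neg, neg_mul, inv_mul_cancel₀ hd0],
    Real.rpow_neg_one, ← div_eq_mul_inv, le_div_iff₀ hk0]
  calc e k ^ d * k ≤ e k ^ d * ((1 + ε) ^ d * (k - K₀)) := by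
        refine mul_le_mul_of_nonneg_left (h1.trans ?_) (pow_nonneg (he k) d)
        exact mul_le_mul_of_nonneg_right h2 hsub
    _ = (1 + ε) ^ d * ((k - K₀) * e k ^ d) := by ring
    _ ≤ (1 + ε) ^ d * B := mul_le_mul_of_nonneg_left (h k hkK) (by positivity)

/-- Each dyadic block of scales below `1` is bounded by packing with a constant depending only on
`A` and `r`. Larger scales contribute finitely many terms, whose number depends on `e 0` and affects
only the threshold `K`. -/
theorem exists_isRateConstant (hq : 2 ≤ q) {A : Set (E q)} (hA : Convex ℝ A) (hc : IsCompact A)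
    (hi : (interior A).Nonempty) {r : ℝ} (hr : 0 < r) (hr1 : r ≤ 1) :
    ∃ c, IsRateConstant r A c := by
  obtain ⟨d, rfl⟩ : ∃ d, q = d + 1 := ⟨q - 1, by omega⟩
  obtain ⟨C, hC, hvol⟩ := exists_volume_cthickening_le hA hc hi 3
  have hne : A.Nonempty := hi.mono interior_subset
  set ω := volume.real (ball (0 : E (d + 1)) 1) with hω_def
  have hω : 0 < ω := ENNReal.toReal_pos (measure_ball_pos _ _ one_pos).ne' measure_ball_lt_top.ne
  set B := 3 * C / ((r / 2) ^ (d + 1) * ω) with hBdef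
  have hB : 0 ≤ B := by positivity
  refine ⟨(2 * B) ^ (1 / (d : ℝ)), by positivity, fun v e he hnn hsep hlow hup ε hε => ?_⟩
  have hblock : ∀ k ε, 0 < ε → ε ≤ 1 →
      (((Finset.range k).filter (fun i => ε ≤ e i ∧ e i ≤ 2 * ε)).card : ℝ) * ε ^ d ≤ B := by
    intro k ε hε hε1
    -- Points of the block are within `2ε` of `A`, so balls of radius `rε/2` fit in the
    -- `3ε`-parallel body; the volume bound was taken up to `3` for this reason.
    have hrε : r * ε ≤ ε := mul_le_of_le_one_left hε.le hr1
    have key := card_mul_volume_ball_le (q := d + 1) hc hne (ρ := r / 2 * ε) (T := 3 * ε)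
      (by positivity) (v := v) (S := (Finset.range k).filter (fun i => ε ≤ e i ∧ e i ≤ 2 * ε))
      (fun i hi j _ hij => by
        have := mul_le_mul_of_nonneg_left (Finset.mem_filter.mp hi).2.1 hr.le
        linarith [hsep i j hij])
      (fun i hi => by
        have := mul_le_mul_of_nonneg_left (Finset.mem_filter.mp hi).2.1 hr.le
        have : 0 < r * ε := by positivity
        linarith [hlow i])
      (fun i hi => by linarith [hup i, (Finset.mem_filter.mp hi).2.2])
    have key2 := hvol (3 * ε) (by positivity) (by linarith)
    rw [hBdef, le_div_iff₀ (by positivity)]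
    -- The balls have volume of order `ε ^ (d + 1)` and the shell of order `ε`; cancelling one
    -- factor produces the exponent `d = q - 1`.
    refine le_of_mul_le_mul_right (a := ε) ?_ hε
    rw [mul_pow] at key
    calc _ = (((Finset.range k).filter (fun i => ε ≤ e i ∧ e i ≤ 2 * ε)).card : ℝ) *
          ((r / 2) ^ (d + 1) * ε ^ (d + 1) * ω) := by ring
      _ ≤ _ := by linarith
  obtain ⟨K₀, hK₀⟩ : ∃ K₀ : ℕ, ∀ k, countGe e k 1 ≤ K₀ := by
    obtain ⟨K₀, hK₀⟩ := exists_nat_ge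
      (volume.real (cthickening (e 0 + r / 2) A) / ((r / 2) ^ (d + 1) * ω))
    refine ⟨K₀, fun k => ?_⟩
    have key := card_mul_volume_ball_le (q := d + 1) hc hne (ρ := r / 2) (T := e 0 + r / 2)
      (by positivity) (v := v) (S := (Finset.range k).filter (fun i => 1 ≤ e i))
      (fun i hi j _ hij => by
        have := mul_le_mul_of_nonneg_left (Finset.mem_filter.mp hi).2 hr.le
        linarith [hsep i j hij])
      (fun i hi => by
        have := mul_le_mul_of_nonneg_left (Finset.mem_filter.mp hi).2 hr.le
        linarith [hlow i])
      (fun i _ => by linarith [hup i, he (Nat.zero_le i)])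
    rw [div_le_iff₀ (by positivity)] at hK₀
    have h0 : 0 ≤ volume.real A := measureReal_nonneg
    have : (countGe e k 1 : ℝ) ≤ K₀ :=
      le_of_mul_le_mul_right (a := (r / 2) ^ (d + 1) * ω) (by rw [countGe]; linarith)
        (by positivity)
    exact_mod_cast this
  refine eventually_le_of_sub_mul_pow_le (K₀ := K₀) (by omega) (by positivity) (fun k hk => ?_)
    hnn hε
  rcases (hnn k).eq_or_lt with h0 | hpos
  · rw [← h0, zero_pow (by omega), mul_zero]
    positivity
  have hle1 : e k ≤ 1 := by
    by_contra! h
    have h1 := hK₀ k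
    rw [countGe_eq_of_le he (Nat.le_succ k) h.le] at h1
    omega
  -- At scale `e k` all of the first `k` terms are counted, by monotonicity, so the count becomes
  -- `k`.
  have h1 := countGe_mul_pow_le (by omega : 1 ≤ d) hB (hblock k) hpos hle1
  rw [countGe_eq_of_le he (Nat.le_succ k) le_rfl] at h1
  have h2 : (countGe e k 1 : ℝ) * e k ^ d ≤ K₀ * e k ^ d :=
    mul_le_mul_of_nonneg_right (by exact_mod_cast hK₀ k) (by positivity)
  linarith

end Packing

/-! ### Runs of the algorithm -/

lemma IsPolytope.isClosed {q : ℕ} {S : Set (E q)} (h : IsPolytope S) : IsClosed S := by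
  obtain ⟨⟨N, a, b, rfl⟩, -⟩ := h
  rw [Set.ofPred_forall]
  exact isClosed_iInter fun i => isClosed_le continuous_const (by fun_prop)

lemma IsPolytope.isCompact {q : ℕ} {S : Set (E q)} (h : IsPolytope S) : IsCompact S :=
  Metric.isCompact_of_isClosed_isBounded h.isClosed h.2

lemma IsPolytope.convex {q : ℕ} {S : Set (E q)} (h : IsPolytope S) : Convex ℝ S := by
  obtain ⟨⟨N, a, b, rfl⟩, -⟩ := h
  rw [Set.ofPred_forall]
  exact convex_iInter fun i =>
    convex_halfSpace_ge ⟨fun _ _ => inner_add_right _ _ _, fun _ _ => real_inner_smul_right _ _ _⟩ _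

lemma IsPolytope.inter_halfspace {q : ℕ} {S : Set (E q)} (h : IsPolytope S) (g : E q) (c : ℝ) :
    IsPolytope (S ∩ {y | c ≤ inner ℝ g y}) := by
  obtain ⟨⟨N, a, b, rfl⟩, hb⟩ := h
  refine ⟨⟨N + 1, Fin.cons g a, Fin.cons c b, ?_⟩, hb.subset Set.inter_subset_left⟩
  ext y
  simp [Fin.forall_fin_succ, and_comm]

namespace Run

variable {n q : ℕ} {p : Problem n q} {ε₀ : ℝ} (R : Run p ε₀)

/-- The cut-normal `g^k = w^k - λ^k w̄`. -/
def cutNormal (k : ℕ) : E q := R.dualVec k - R.dualMul k • p.wbar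

/-- The optimal value of the scalarization at the selected vertex. -/
def value (k : ℕ) : ℝ := mnorm (R.metric k) (R.zsol k (R.vertex k))

lemma value_nonneg (k : ℕ) : 0 ≤ R.value k := Real.sqrt_nonneg _

lemma isPolytope_approx (k : ℕ) : IsPolytope (R.approx k) := by
  induction k with
  | zero => exact R.init_polytope
  | succ k ih =>
    rw [R.update]
    exact ih.inter_halfspace _ _

lemma metric_posSemidef (hε : 0 < ε₀) (k : ℕ) : (R.metric k).PosSemidef :=
  adaptiveMetric_posSemidef hε R.u k

lemma approx_succ (hε : 0 < ε₀) (k : ℕ) :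
    R.approx (k + 1) = R.approx k ∩ suppHalfspace (R.cutNormal k) p.slice := by
  rw [R.update, suppHalfspace, cutNormal, p.supportFn_cut_normal (R.metric_posSemidef hε k)
    (R.primal_optimal k _ (R.vertex_mem k)) (R.dual_optimal k)]

lemma subset_suppHalfspace (w : E q) : p.slice ⊆ suppHalfspace w p.slice := by
  intro y hy
  rw [suppHalfspace, Set.mem_ofPred_eq, supportFn]
  refine csInf_le ?_ (Set.mem_image_of_mem _ hy)
  exact (p.isCompact_slice.image (by fun_prop : Continuous fun y : E q => inner ℝ w y)).bddBelow

lemma slice_subset_approx (hε : 0 < ε₀) (k : ℕ) : p.slice ⊆ R.approx k := by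
  induction k with
  | zero => exact R.init_outer
  | succ k ih =>
    rw [R.approx_succ hε]
    exact Set.subset_inter ih (subset_suppHalfspace _)

lemma approx_antitone : Antitone R.approx :=
  antitone_nat_of_succ_le fun k => by
    rw [R.update]
    exact Set.inter_subset_left

lemma approx_nonempty (hε : 0 < ε₀) (k : ℕ) : (R.approx k).Nonempty :=
  p.slice_nonempty.mono (R.slice_subset_approx hε k)

lemma hausdorffEDist_ne_top (hε : 0 < ε₀) (k : ℕ) {S : Set (E q)} (hS : S.Nonempty)
    (hb : Bornology.IsBounded S) : Metric.hausdorffEDist (R.approx k) S ≠ ⊤ :=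
  Metric.hausdorffEDist_ne_top_of_nonempty_of_bounded (R.approx_nonempty hε k) hS
    (R.isPolytope_approx k).2 hb

lemma infDist_le_error (hε : 0 < ε₀) {k : ℕ} {y : E q} (hy : y ∈ R.approx k) :
    Metric.infDist y p.slice ≤ R.error k :=
  Metric.infDist_le_hausdorffDist_of_mem hy
    (R.hausdorffEDist_ne_top hε k p.slice_nonempty p.isBounded_slice)

lemma error_le (hε : 0 < ε₀) {k : ℕ} {b : ℝ} (hb : 0 ≤ b)
    (h : ∀ y ∈ R.approx k, Metric.infDist y p.slice ≤ b) : R.error k ≤ b :=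
  Metric.hausdorffDist_le_of_infDist hb h fun y hy => by
    rwa [Metric.infDist_zero_of_mem (R.slice_subset_approx hε k hy)]

lemma error_nonneg (k : ℕ) : 0 ≤ R.error k := Metric.hausdorffDist_nonneg

lemma error_antitone (hε : 0 < ε₀) : Antitone R.error := fun _ _ hij =>
  R.error_le hε (R.error_nonneg _) fun _ hy => R.infDist_le_error hε (R.approx_antitone hij hy)

open scoped Pointwise in
/-- Every point of the outer approximation reaches the slice by a step of `M`-length at most the
value at the selected vertex. -/
lemma exists_step_le_value (hε : 0 < ε₀) {k : ℕ} {y : E q} (hy : y ∈ R.approx k) :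
    ∃ z : E q, y + z ∈ p.slice ∧ mnorm (R.metric k) z ≤ R.value k := by
  obtain ⟨L, hL⟩ := exists_clm_norm_eq_mnorm (R.metric_posSemidef hε k)
  set B : Set (E q) := {z | ‖L z‖ ≤ R.value k} with hB
  have hclosed : IsClosed (p.slice + B) :=
    (isClosed_le (by fun_prop) continuous_const : IsClosed B).add_left_of_isCompact
      p.isCompact_slice
  have hBconv : Convex ℝ B := by
    intro x hx z hz a b ha hb hab
    have hx' : ‖L x‖ ≤ R.value k := hx
    have hz' : ‖L z‖ ≤ R.value k := hz
    show ‖L (a • x + b • z)‖ ≤ R.value k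
    rw [map_add, map_smul, map_smul]
    refine (norm_add_le _ _).trans ?_
    rw [norm_smul, norm_smul, Real.norm_of_nonneg ha, Real.norm_of_nonneg hb]
    calc a * ‖L x‖ + b * ‖L z‖ ≤ a * R.value k + b * R.value k := by gcongr
      _ = R.value k := by rw [← add_mul, hab, one_mul]
  -- By Krein–Milman it is enough to check the extreme points, where the maximality of the selected
  -- vertex applies.
  have hsub : R.approx k ⊆ p.slice + B := by
    rw [← closure_convexHull_extremePoints (R.isPolytope_approx k).isCompact
      (R.isPolytope_approx k).convex]
    refine closure_minimal (convexHull_min ?_ (p.convex_slice.add hBconv)) hclosed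
    intro v hv
    have h1 := R.vertex_max k v hv
    refine ⟨_, p.exists_primalFeasible_iff.mp ⟨_, (R.primal_optimal k v hv).1⟩, -R.zsol k v, ?_,
      by simp⟩
    show ‖L (-R.zsol k v)‖ ≤ R.value k
    rw [map_neg, norm_neg, ← hL]
    exact h1
  obtain ⟨a, ha, b, hb, rfl⟩ := hsub hy
  refine ⟨-b, by simpa using ha, ?_⟩
  rw [hL, map_neg, norm_neg]
  exact hb

lemma sqrt_sInf_spectrum_mul_error_le (hq : 0 < q) (hε : 0 < ε₀) (k : ℕ) :
    √(sInf (spectrum ℝ (R.metric k))) * R.error k ≤ R.value k := by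
  have hpos : 0 < sInf (spectrum ℝ (R.metric k)) :=
    hε.trans_le (le_sInf_spectrum_adaptiveMetric hq ε₀ R.u_unit k)
  rw [mul_comm, ← le_div_iff₀ (Real.sqrt_pos.mpr hpos)]
  refine R.error_le hε (div_nonneg (R.value_nonneg k) (Real.sqrt_nonneg _)) fun y hy => ?_
  obtain ⟨z, hz, hzv⟩ := R.exists_step_le_value hε hy
  refine (Metric.infDist_le_dist_of_mem hz).trans ?_
  rw [dist_self_add_right, le_div_iff₀ (Real.sqrt_pos.mpr hpos)]
  refine le_trans ?_ hzv
  refine Real.le_sqrt_of_sq_le ?_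
  rw [← mnorm_sq (R.metric_posSemidef hε k), mul_pow, Real.sq_sqrt hpos.le, mul_comm]
  exact sInf_spectrum_mul_norm_sq_le (R.metric_posSemidef hε k) z

/-- Any `y` surviving the cut has `g · (y - v) ≥ g · z`, which is the value; Cauchy–Schwarz and the
norm bound on `g` turn this into a distance. -/
lemma value_le_mul_infDist (hε : 0 < ε₀) (k : ℕ) :
    R.value k ≤ √(sSup (spectrum ℝ (R.metric k))) *
      Metric.infDist (R.vertex k) (R.approx (k + 1)) := by
  have hp := R.primal_optimal k _ (R.vertex_mem k)
  have hM := R.metric_posSemidef hε k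
  obtain ⟨y, hy, hdist⟩ := (R.isPolytope_approx (k + 1)).isCompact.exists_infDist_eq_dist
    (R.approx_nonempty hε (k + 1)) (R.vertex k)
  rw [hdist]
  rw [R.update] at hy
  have h1 : inner ℝ (R.cutNormal k) (R.vertex k + R.zsol k (R.vertex k)) ≤
    inner ℝ (R.cutNormal k) y := hy.2
  have h2 : inner ℝ (R.cutNormal k) (R.zsol k (R.vertex k)) = R.value k :=
    p.inner_cut_normal_eq hM hp (R.dual_optimal k)
  have h3 : ‖R.cutNormal k‖ ≤ √(sSup (spectrum ℝ (R.metric k))) :=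
    p.norm_cut_normal_le hM hp (R.dual_optimal k)
  rw [inner_add_right, h2] at h1
  calc R.value k ≤ inner ℝ (R.cutNormal k) (y - R.vertex k) := by
        rw [inner_sub_right]
        linarith
    _ ≤ ‖R.cutNormal k‖ * ‖y - R.vertex k‖ := real_inner_le_norm _ _
    _ ≤ _ := by
        rw [dist_comm, dist_eq_norm]
        gcongr

lemma error_le_sqrt_condNumber_mul_infDist (hq : 0 < q) (hε : 0 < ε₀) (k : ℕ) :
    R.error k ≤ √(condNumber (R.metric k)) *
      Metric.infDist (R.vertex k) (R.approx (k + 1)) := by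
  have hpos : 0 < sInf (spectrum ℝ (R.metric k)) :=
    hε.trans_le (le_sInf_spectrum_adaptiveMetric hq ε₀ R.u_unit k)
  have h := (R.sqrt_sInf_spectrum_mul_error_le hq hε k).trans (R.value_le_mul_infDist hε k)
  rw [condNumber, Real.sqrt_div' _ hpos.le, div_mul_eq_mul_div, le_div_iff₀ (Real.sqrt_pos.mpr hpos)]
  linarith

lemma bddAbove_sqrt_condNumber (hq : 0 < q) (hε : 0 < ε₀) :
    BddAbove (Set.range fun k : ℕ => √(condNumber (R.metric k))) := by
  refine ⟨√((ε₀ + 1) / ε₀), ?_⟩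
  rintro _ ⟨k, rfl⟩
  exact Real.sqrt_le_sqrt (condNumber_adaptiveMetric_le hq hε R.u_unit k)

lemma one_le_thetaBar (hq : 0 < q) (hε : 0 < ε₀) : 1 ≤ R.thetaBar := by
  refine le_trans ?_ (le_ciSup (R.bddAbove_sqrt_condNumber hq hε) 0)
  rw [Real.one_le_sqrt]
  exact one_le_condNumber hq (adaptiveMetric_isHermitian _ _ _)
    (hε.trans_le (le_sInf_spectrum_adaptiveMetric hq ε₀ R.u_unit 0))

lemma ratio_mul_error_le_infDist (hq : 0 < q) (hε : 0 < ε₀) (k : ℕ) :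
    1 / R.thetaBar ^ 3 * R.error k ≤ Metric.infDist (R.vertex k) (R.approx (k + 1)) := by
  have h1 := R.one_le_thetaBar hq hε
  rw [one_div, inv_mul_le_iff₀ (by positivity)]
  refine (R.error_le_sqrt_condNumber_mul_infDist hq hε k).trans ?_
  refine mul_le_mul_of_nonneg_right ?_ Metric.infDist_nonneg
  -- The argument yields the ratio `1 / θ̄`; the cube only weakens it, because `θ̄ ≥ 1`.
  exact (le_ciSup (R.bddAbove_sqrt_condNumber hq hε) k).trans (le_self_pow₀ h1 (by norm_num))

lemma ratio_mul_error_le_hausdorffDist (hq : 0 < q) (hε : 0 < ε₀) (k : ℕ) :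
    1 / R.thetaBar ^ 3 * R.error k ≤ Metric.hausdorffDist (R.approx k) (R.approx (k + 1)) :=
  (R.ratio_mul_error_le_infDist hq hε k).trans <|
    Metric.infDist_le_hausdorffDist_of_mem (R.vertex_mem k).1
      (R.hausdorffEDist_ne_top hε k (R.approx_nonempty hε _) (R.isPolytope_approx _).2)

lemma isHSequence (hq : 0 < q) (hε : 0 < ε₀)
    (h : ∃ (J : ℕ) (ω : Fin J → E q), (∀ j, ω j ≠ 0) ∧
      R.approx 0 = (⋂ j, suppHalfspace (ω j) p.slice) ∩ capHalfspace p.wbar p.γ) :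
    IsHSequence (1 / R.thetaBar ^ 3) p.slice R.approx where
  body_nonempty := p.slice_nonempty
  body_convex := p.convex_slice
  body_compact := p.isCompact_slice
  ratio_pos := by
    have := R.one_le_thetaBar hq hε
    positivity
  polytope := R.isPolytope_approx
  init := by
    obtain ⟨J, ω, hω, h0⟩ := h
    refine ⟨J + 1, Fin.cons (-p.wbar) ω, ?_, ?_⟩
    · rw [Fin.forall_fin_succ]
      exact ⟨by simpa using p.wbar_ne_zero, by simpa using hω⟩
    · rw [h0, p.capHalfspace_eq_suppHalfspace]
      ext y
      simp [Fin.forall_fin_succ, and_comm]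
  outer := R.slice_subset_approx hε
  cut k := by
    rcases eq_or_ne (R.cutNormal k) 0 with h0 | h0
    -- A zero normal cuts nothing, and neither does the cap, which already contains `A_k`; it
    -- supplies the nonzero normal.
    · refine ⟨-p.wbar, neg_ne_zero.mpr p.wbar_ne_zero, ?_⟩
      have hsub : R.approx k ⊆ suppHalfspace (-p.wbar) p.slice := by
        obtain ⟨J, ω, -, hA⟩ := h
        rw [← p.capHalfspace_eq_suppHalfspace]
        refine (R.approx_antitone (Nat.zero_le k)).trans ?_
        rw [hA]
        exact Set.inter_subset_right
      rw [Set.inter_eq_left.mpr hsub, R.update]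
      refine Set.inter_eq_left.mpr fun y _ => ?_
      rw [cutNormal] at h0
      simp [h0]
    · exact ⟨_, h0, R.approx_succ hε k⟩
  ratio := R.ratio_mul_error_le_hausdorffDist hq hε

/-- The selected vertices are the separated points: every later one lies in `A_{i+1}`, as does the
slice, so the distance from `v^i` to `A_{i+1}` bounds both distances from below. -/
lemma error_le_of_isRateConstant (hq : 0 < q) (hε : 0 < ε₀) {c : ℝ}
    (hc : IsRateConstant (1 / R.thetaBar ^ 3) p.slice c) {ε : ℝ} (hε' : 0 < ε) :
    ∃ K : ℕ, ∀ k : ℕ, K ≤ k → R.error k ≤ (1 + ε) * c * (k : ℝ) ^ (1 / (1 - (q : ℝ))) :=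
  hc.2 R.vertex R.error (R.error_antitone hε) R.error_nonneg
    (fun i j hij => (R.ratio_mul_error_le_infDist hq hε i).trans
      (Metric.infDist_le_dist_of_mem (R.approx_antitone hij (R.vertex_mem j).1)))
    (fun i => (R.ratio_mul_error_le_infDist hq hε i).trans
      (Metric.infDist_le_infDist_of_subset (R.slice_subset_approx hε _) p.slice_nonempty))
    (fun i => R.infDist_le_error hε (R.vertex_mem i).1) ε hε'

end Run

open Classical in
/-- The constant in the rate of convergence of a sequence of cutting with ratio `r` around `A`. -/
def rateConstant {q : ℕ} (r : ℝ) (A : Set (E q)) : ℝ :=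
  if h : ∃ c, IsRateConstant r A c then h.choose else 0

lemma isRateConstant_rateConstant {q : ℕ} {r : ℝ} {A : Set (E q)}
    (h : ∃ c, IsRateConstant r A c) : IsRateConstant r A (rateConstant r A) := by
  rw [rateConstant, dif_pos h]
  exact h.choose_spec

end AdaptiveCVOP

end

theorem theorem4 (q : ℕ) (hq : 2 ≤ q) :
    ∃ lam : ℝ → Set (AdaptiveCVOP.E q) → ℝ,
      ∀ (n : ℕ) (p : AdaptiveCVOP.Problem n q) (ε₀ : ℝ), 0 < ε₀ →
        ∀ R : AdaptiveCVOP.Run p ε₀,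
          BddAbove (Set.range fun k : ℕ =>
            Real.sqrt (AdaptiveCVOP.condNumber (R.metric k))) ∧
          ((∃ (J : ℕ) (ω : Fin J → AdaptiveCVOP.E q), (∀ j, ω j ≠ 0) ∧
              R.approx 0 = (⋂ j, AdaptiveCVOP.suppHalfspace (ω j) p.slice) ∩
                AdaptiveCVOP.capHalfspace p.wbar p.γ) →
            AdaptiveCVOP.IsHSequence (1 / R.thetaBar ^ 3) p.slice R.approx) ∧
          (∀ k, 1 / R.thetaBar ^ 3 * R.error k ≤
            Metric.hausdorffDist (R.approx k) (R.approx (k + 1))) ∧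
          ∀ ε : ℝ, 0 < ε → ε < 1 → ∃ K : ℕ, ∀ k : ℕ, K ≤ k →
            R.error k ≤ (1 + ε) * lam (1 / R.thetaBar ^ 3) p.slice *
              (k : ℝ) ^ (1 / (1 - (q : ℝ))) := by
  have hq0 : 0 < q := by omega
  -- The constant is fixed before the problem and the run, so it depends on them only through `r`
  -- and the slice.
  refine ⟨AdaptiveCVOP.rateConstant, fun n p ε₀ hε₀ R =>
    ⟨R.bddAbove_sqrt_condNumber hq0 hε₀, R.isHSequence hq0 hε₀,
      R.ratio_mul_error_le_hausdorffDist hq0 hε₀, fun ε hε _ => ?_⟩⟩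
  have hθ := R.one_le_thetaBar hq0 hε₀
  refine R.error_le_of_isRateConstant hq0 hε₀ (AdaptiveCVOP.isRateConstant_rateConstant ?_) hε
  refine AdaptiveCVOP.exists_isRateConstant hq p.convex_slice p.isCompact_slice
    p.interior_slice_nonempty (by positivity) ?_
  rw [div_le_one (by positivity)]
  exact one_le_pow₀ hθ
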